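/- There exists a compactification $\gamma\omega$ of the countable discrete space $\omega$ (that is, a compact Hausdorff space $\gamma\omega$ containing $\omega$ as a dense subspace with the discrete topology) such that the remainder $\gamma\omega\setminus\omega$, with the subspace topology, is not separable and supports a measure, i.e. there is a regular Borel probability measure on $\gamma\omega\setminus\omega$ that is positive on every nonempty open subset. -/

import Mathlib

/-- A Hausdorff compactification of a topological space `D`: a compact Hausdorff space `X` together
with an embedding `i : D → X` (a homeomorphism onto its image) whose image is dense. -/
structure IsCompactification {D X : Type*} [TopologicalSpace D] [TopologicalSpace X]
    (i : D → X) : Prop where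
  compactSpace : CompactSpace X
  t2Space : T2Space X
  isEmbedding : Topology.IsEmbedding i
  denseRange : DenseRange i

/-- The remainder `X \ i(D)`; as a type it carries the subspace topology. -/
abbrev remainder {D X : Type*} (i : D → X) : Set X := (Set.range i)ᶜ

/-- `K` supports a measure: there is a regular probability measure on the Borel σ-algebra of `K`
that is positive on every nonempty open set. -/
def SupportsMeasure (K : Type*) [TopologicalSpace K] : Prop :=
  ∃ (_ : MeasurableSpace K) (_ : BorelSpace K) (μ : MeasureTheory.Measure K),
    MeasureTheory.IsProbabilityMeasure μ ∧ μ.Regular ∧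
      ∀ U : Set K, IsOpen U → U.Nonempty → 0 < μ U

/-! The isolated points are the nodes of a tree whose level `n` nodes have `n + 2` successors. A
selector `π` picks one node of each length `m + 1`; its coordinate is true at the nodes extending a
picked one. The space is the closure of the resulting 0-1 codes. Every remainder point lies over a
branch (`exists_branch`). Given countably many points, let `π` pick from the `m`-th branch: its
coordinate is true at all of them, but false at a branch that avoids every pick, so they are not
dense. The measure comes from uniform measure on branches. A basic open set with `k` coordinates
that meets the remainder contains nodes of length `L ≥ k`. Among branches through such a node, each
selector's later picks catch at most a fraction `1 / (L + 1)`, so `k` selectors leave positive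
measure, and the branches left share the node's coordinates. -/

open MeasureTheory Set Filter Topology

/-! ### Measures on zero-dimensional compact spaces -/

/-- A map from a probability space into a zero-dimensional compact space which pulls nonempty clopen
sets back to measurable sets of positive measure yields a strictly positive regular Borel
probability measure, even if the map is not Borel measurable. -/
theorem supportsMeasure_of_preimage_clopen {Ω K : Type*} [MeasurableSpace Ω] (P : Measure Ω)
    [IsProbabilityMeasure P] [TopologicalSpace K] [CompactSpace K] [T2Space K]
    [TotallyDisconnectedSpace K] (φ : Ω → K)
    (hmeas : ∀ W : Set K, IsClopen W → MeasurableSet (φ ⁻¹' W))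
    (hpos : ∀ W : Set K, IsClopen W → W.Nonempty → 0 < P (φ ⁻¹' W)) :
    SupportsMeasure K := by
  let c : Content K :=
    { toFun := fun C => (P (φ ⁻¹' (C : Set K))).toNNReal
      mono' := fun C₁ C₂ h =>
        ENNReal.toNNReal_mono (measure_ne_top _ _) (measure_mono (preimage_mono h))
      sup_disjoint' := by
        intro C₁ C₂ hd h₁ h₂
        -- Preimages of compact sets may be non-measurable; additivity comes from cutting by the
        -- measurable preimage of a separating clopen set.
        obtain ⟨W, hW, h₁W, hW₂⟩ := exists_clopen_of_closed_subset_open h₁ h₂.isOpen_compl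
          hd.subset_compl_right
        have hd₂ : Disjoint W (C₂ : Set K) := disjoint_left.2 fun x hx hx' => hW₂ hx hx'
        rw [← ENNReal.toNNReal_add (measure_ne_top _ _) (measure_ne_top _ _),
          ← measure_inter_add_sdiff (φ ⁻¹' ((C₁ ⊔ C₂ : TopologicalSpace.Compacts K) : Set K))
            (hmeas W hW), ← preimage_inter, ← preimage_sdiff, TopologicalSpace.Compacts.coe_sup,
          union_inter_distrib_right, inter_eq_left.2 h₁W, hd₂.symm.inter_eq, union_empty,
          union_sdiff_distrib, sdiff_eq_empty.2 h₁W, empty_union, hd₂.symm.sdiff_eq_left]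
      sup_le' := by
        intro C₁ C₂
        rw [← ENNReal.toNNReal_add (measure_ne_top _ _) (measure_ne_top _ _)]
        refine ENNReal.toNNReal_mono (by finiteness) ?_
        rw [TopologicalSpace.Compacts.coe_sup, preimage_union]
        exact measure_union_le _ _ }
  have hc : ∀ C : TopologicalSpace.Compacts K, c C = P (φ ⁻¹' (C : Set K)) := fun C =>
    ENNReal.coe_toNNReal (measure_ne_top _ _)
  have hclopen : ∀ W : Set K, IsClopen W → c.outerMeasure W = P (φ ⁻¹' W) := by
    intro W hW
    rw [c.outerMeasure_of_isOpen W hW.isOpen,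
      c.innerContent_of_isCompact hW.isClosed.isCompact hW.isOpen, hc]
    rfl
  let : MeasurableSpace K := borel K
  have : BorelSpace K := ⟨rfl⟩
  refine ⟨inferInstance, inferInstance, c.measure, ⟨?_⟩, inferInstance, ?_⟩
  · rw [c.measure_apply MeasurableSet.univ, hclopen _ isClopen_univ, preimage_univ, measure_univ]
  · rintro U hU ⟨y, hy⟩
    obtain ⟨W, hW, hyW, hWU⟩ := compact_exists_isClopen_in_isOpen hU hy
    refine lt_of_lt_of_le ?_ (measure_mono hWU)
    rw [c.measure_apply hW.isOpen.measurableSet, hclopen W hW]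
    exact hpos W hW ⟨y, hyW⟩

/-- An open set in a space embedded in a power of `Bool` is a neighbourhood determined by
finitely many coordinates of each of its points. -/
theorem Topology.IsEmbedding.exists_finset_coordinates {I K : Type*} [TopologicalSpace K]
    {g : K → I → Bool} (hg : IsEmbedding g) {W : Set K} (hW : IsOpen W) {y : K} (hy : y ∈ W) :
    ∃ F : Finset I, {z | ∀ j ∈ F, g z j = g y j} ⊆ W := by
  obtain ⟨O, hO, rfl⟩ := hg.isOpen_iff.1 hW
  obtain ⟨F, u, hu, hF⟩ := isOpen_pi_iff.1 hO _ hy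
  exact ⟨F, fun z hz => hF fun j hj => by simpa only [hz j hj] using (hu j hj).2⟩

theorem isClopen_coordinates {I K : Type*} [TopologicalSpace K] {g : K → I → Bool}
    (hg : Continuous g) (F : Finset I) (b : I → Bool) : IsClopen {z | ∀ j ∈ F, g z j = b j} := by
  have : {z | ∀ j ∈ F, g z j = b j} = ⋂ j ∈ F, (fun z => g z j) ⁻¹' {b j} := by ext; simp
  rw [this]
  exact isClopen_biInter_finset fun j _ =>
    (isClopen_discrete _).preimage ((continuous_apply j).comp hg)

theorem measurableSet_coordinates {Ω I : Type*} [MeasurableSpace Ω] {f : Ω → I → Bool}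
    (hf : ∀ j, Measurable fun x => f x j) (F : Finset I) (b : I → Bool) :
    MeasurableSet {x | ∀ j ∈ F, f x j = b j} := by
  have : {x | ∀ j ∈ F, f x j = b j} = ⋂ j ∈ F, (fun x => f x j) ⁻¹' {b j} := by ext; simp
  rw [this]
  exact F.measurableSet_biInter fun j _ => hf j (measurableSet_singleton _)

/-- By compactness a clopen set is a finite union of coordinate boxes; for open sets the union could
be uncountable. -/
theorem measurableSet_preimage_clopen {Ω I K : Type*} [MeasurableSpace Ω] [TopologicalSpace K]
    [CompactSpace K] {g : K → I → Bool} (hg : IsEmbedding g) {φ : Ω → K}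
    (hφ : ∀ j, Measurable fun x => g (φ x) j) {W : Set K} (hW : IsClopen W) :
    MeasurableSet (φ ⁻¹' W) := by
  choose! F hF using fun y (hy : y ∈ W) => hg.exists_finset_coordinates hW.isOpen hy
  obtain ⟨t, ht, hWt⟩ := hW.isClosed.isCompact.elim_nhds_subcover
    (fun y => {z | ∀ j ∈ F y, g z j = g y j})
    fun y _ => (isClopen_coordinates hg.continuous _ _).isOpen.mem_nhds fun _ _ => rfl
  have : φ ⁻¹' W = ⋃ y ∈ t, {x | ∀ j ∈ F y, g (φ x) j = g y j} := by
    ext x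
    constructor
    · intro hx
      simpa using hWt hx
    · intro hx
      obtain ⟨y, hy, hxy⟩ : ∃ y ∈ t, ∀ j ∈ F y, g (φ x) j = g y j := by simpa using hx
      exact hF y (ht y hy) hxy
  rw [this]
  exact t.measurableSet_biUnion fun y _ => measurableSet_coordinates hφ _ _

/-! ### The tree -/

/-- The branches of the tree whose nodes at level `n` have `n + 2` successors. -/
abbrev Branch : Type := (n : ℕ) → Fin (n + 2)

/-- The nodes of the tree, as finite sequences together with their lengths. -/
abbrev Node : Type := Σ n : ℕ, (i : Fin n) → Fin (i + 2)

/-- The branches which agree with `a` below `n`. -/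
def cyl (n : ℕ) (a : Branch) : Set Branch := {x | ∀ i < n, x i = a i}

theorem cyl_eq_pi (n : ℕ) (a : Branch) :
    cyl n a = Set.pi (Finset.range n : Set ℕ) fun i => {a i} := by
  ext x; simp [cyl, Set.mem_pi]

theorem mem_cyl_comm {n : ℕ} {a x : Branch} : x ∈ cyl n a ↔ a ∈ cyl n x :=
  forall₂_congr fun _ _ => eq_comm

theorem mem_cyl_self (n : ℕ) (a : Branch) : a ∈ cyl n a := fun _ _ => rfl

theorem isClopen_cyl (n : ℕ) (a : Branch) : IsClopen (cyl n a) := by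
  rw [cyl_eq_pi, Set.pi_def]
  exact isClopen_biInter_finset fun i _ => (isClopen_discrete _).preimage (continuous_apply i)

theorem measurableSet_cyl (n : ℕ) (a : Branch) : MeasurableSet (cyl n a) := by
  rw [cyl_eq_pi]
  exact MeasurableSet.pi (Finset.countable_toSet _) fun i _ => measurableSet_singleton _

/-- The node of length `n` on a branch. -/
def Branch.node (x : Branch) (n : ℕ) : Node := ⟨n, fun i => x i⟩

/-- The branch extending a node by zeros. -/
def Node.extend (s : Node) : Branch := fun i => if h : i < s.1 then s.2 ⟨i, h⟩ else 0

theorem Branch.extend_node_mem_cyl (x : Branch) (n : ℕ) : (x.node n).extend ∈ cyl n x := by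
  intro i hi
  simp [Branch.node, Node.extend, hi]

instance : Infinite Node := Infinite.of_injective (fun n => ⟨n, fun _ => 0⟩) fun _ _ h =>
  congrArg Sigma.fst h

theorem finite_setOf_length_lt (n : ℕ) : {t : Node | t.1 < n}.Finite := by
  have : {t : Node | t.1 < n} = ⋃ m ∈ Finset.range n, range (Sigma.mk m) := by
    ext ⟨m, s⟩
    simp only [mem_ofPred_eq, mem_iUnion, Finset.mem_range, mem_range]
    constructor
    · exact fun h => ⟨m, h, s, rfl⟩
    · rintro ⟨k, hk, r, hr⟩
      cases hr
      exact hk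
  rw [this]
  exact Finite.biUnion (Finset.finite_toSet _) fun _ _ => finite_range _

/-- The uniform measure on the branches. -/
noncomputable def branchMeasure : Measure Branch :=
  Measure.infinitePi fun n => (PMF.uniformOfFintype (Fin (n + 2))).toMeasure

instance : IsProbabilityMeasure branchMeasure := by
  unfold branchMeasure; infer_instance

theorem branchMeasure_cyl (n : ℕ) (a : Branch) :
    branchMeasure (cyl n a) = ∏ i ∈ Finset.range n, ((i + 2 : ℕ) : ENNReal)⁻¹ := by
  rw [cyl_eq_pi, branchMeasure, Measure.infinitePi_pi _ fun i _ => measurableSet_singleton _]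
  refine Finset.prod_congr rfl fun i _ => ?_
  rw [PMF.toMeasure_apply_singleton _ _ (measurableSet_singleton _)]
  simp

theorem branchMeasure_cyl_pos (n : ℕ) (a : Branch) : 0 < branchMeasure (cyl n a) := by
  rw [branchMeasure_cyl]
  exact pos_iff_ne_zero.2 (Finset.prod_ne_zero_iff.2 fun i _ =>
    ENNReal.inv_ne_zero.2 (ENNReal.natCast_ne_top _))

theorem branchMeasure_cyl_succ (n : ℕ) (a b : Branch) :
    ((n + 2 : ℕ) : ENNReal) * branchMeasure (cyl (n + 1) a) = branchMeasure (cyl n b) := by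
  rw [branchMeasure_cyl, branchMeasure_cyl, Finset.prod_range_succ, mul_comm, mul_assoc,
    ENNReal.inv_mul_cancel (by simp) (ENNReal.natCast_ne_top _), mul_one]

/-- The branches passing, for some `m ≥ L`, through the node of length `m + 1` on `π m`. -/
def tailHit (L : ℕ) (π : ℕ → Branch) : Set Branch := ⋃ m, cyl (L + m + 1) (π (L + m))

theorem branchMeasure_tailHit_le (L : ℕ) (π : ℕ → Branch) (a : Branch) :
    ((L + 1 : ℕ) : ENNReal) * branchMeasure (tailHit L π) ≤ branchMeasure (cyl L a) := by
  -- The extra term makes the sum telescope: with `k = L + M`, the two new terms total `L + 2 ≤ k +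
  -- 2` cylinders of length `k + 1`, hence at most one of length `k`.
  have key : ∀ M : ℕ, ∑ m ∈ Finset.range M,
      ((L + 1 : ℕ) : ENNReal) * branchMeasure (cyl (L + m + 1) (π (L + m)))
        + branchMeasure (cyl (L + M) a) ≤ branchMeasure (cyl L a) := by
    intro M
    induction M with
    | zero => simp
    | succ M ih =>
      refine le_trans ?_ ih
      rw [Finset.sum_range_succ, add_assoc]
      gcongr
      rw [← branchMeasure_cyl_succ (L + M) (π (L + M)) a,
        show branchMeasure (cyl (L + (M + 1)) a) = branchMeasure (cyl (L + M + 1) (π (L + M))) by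
          rw [branchMeasure_cyl, branchMeasure_cyl, add_assoc], ← add_one_mul]
      gcongr
      exact_mod_cast (by omega : L + 1 + 1 ≤ L + M + 2)
  calc ((L + 1 : ℕ) : ENNReal) * branchMeasure (tailHit L π)
      ≤ ((L + 1 : ℕ) : ENNReal) * ∑' m, branchMeasure (cyl (L + m + 1) (π (L + m))) := by
        gcongr
        exact measure_iUnion_le _
    _ = ∑' m, ((L + 1 : ℕ) : ENNReal) * branchMeasure (cyl (L + m + 1) (π (L + m))) :=
        ENNReal.tsum_mul_left.symm
    _ ≤ branchMeasure (cyl L a) :=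
        ENNReal.tsum_le_of_sum_range_le fun M => le_trans le_self_add (key M)

/-- Inside a cylinder of length `L`, at most `L` sets `tailHit L π` leave positive measure. -/
theorem branchMeasure_cyl_diff_tailHit_pos {L : ℕ} (T : Finset (ℕ → Branch)) (hT : T.card ≤ L)
    (a : Branch) : 0 < branchMeasure (cyl L a \ ⋃ π ∈ T, tailHit L π) := by
  have hlt : branchMeasure (⋃ π ∈ T, tailHit L π) < branchMeasure (cyl L a) := by
    have hle : ((L + 1 : ℕ) : ENNReal) * branchMeasure (⋃ π ∈ T, tailHit L π)
        ≤ (L : ENNReal) * branchMeasure (cyl L a) :=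
      calc ((L + 1 : ℕ) : ENNReal) * branchMeasure (⋃ π ∈ T, tailHit L π)
          ≤ ((L + 1 : ℕ) : ENNReal) * ∑ π ∈ T, branchMeasure (tailHit L π) := by
            gcongr
            exact measure_biUnion_finset_le _ _
        _ = ∑ π ∈ T, ((L + 1 : ℕ) : ENNReal) * branchMeasure (tailHit L π) := Finset.mul_sum _ _ _
        _ ≤ ∑ _π ∈ T, branchMeasure (cyl L a) :=
            Finset.sum_le_sum fun π _ => branchMeasure_tailHit_le L π a
        _ = (T.card : ENNReal) * branchMeasure (cyl L a) := by simp
        _ ≤ (L : ENNReal) * branchMeasure (cyl L a) := by gcongr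
    by_contra! h
    have h1 : ((L + 1 : ℕ) : ENNReal) * branchMeasure (cyl L a)
        ≤ (L : ENNReal) * branchMeasure (cyl L a) := le_trans (by gcongr) hle
    rw [ENNReal.mul_le_mul_iff_left (branchMeasure_cyl_pos L a).ne' (measure_ne_top _ _)] at h1
    exact absurd (Nat.cast_le.1 h1) (by omega)
  exact lt_of_lt_of_le (tsub_pos_of_lt hlt) le_measure_sdiff

/-! ### The compactification -/

/-- Coordinates for the compactification: the nodes, which make every point isolated, and the
choices `π` of a node of length `m + 1` for each `m`. -/
abbrev Coord : Type := Node ⊕ (ℕ → Branch)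

open Classical in
/-- The coordinates of a node: the coordinate `π` tells whether the node extends one of the nodes
chosen by `π`. -/
noncomputable def nodeCode (s : Node) : Coord → Bool :=
  Sum.elim (fun t => decide (s = t)) fun π => decide (∃ m < s.1, s.extend ∈ cyl (m + 1) (π m))

open Classical in
/-- The limit of `nodeCode` along a branch. -/
noncomputable def branchCode (x : Branch) : Coord → Bool :=
  Sum.elim (fun _ => false) fun π => decide (∃ m, x ∈ cyl (m + 1) (π m))

theorem nodeCode_inr {s : Node} {π : ℕ → Branch} :
    nodeCode s (.inr π) = true ↔ ∃ m < s.1, s.extend ∈ cyl (m + 1) (π m) := by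
  simp [nodeCode]

theorem nodeCode_inl {s t : Node} : nodeCode s (.inl t) = true ↔ s = t := by
  simp [nodeCode]

theorem branchCode_inr {x : Branch} {π : ℕ → Branch} :
    branchCode x (.inr π) = true ↔ ∃ m, x ∈ cyl (m + 1) (π m) := by
  simp [branchCode]

theorem branchCode_inl (x : Branch) (t : Node) : branchCode x (.inl t) = false := rfl

theorem cyl_trans {n m : ℕ} (h : n ≤ m) {x y z : Branch} (hxy : x ∈ cyl m y) (hyz : y ∈ cyl n z) :
    x ∈ cyl n z := fun i hi => (hxy i (hi.trans_le h)).trans (hyz i hi)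

theorem tendsto_nodeCode (x : Branch) :
    Tendsto (fun n => nodeCode (x.node n)) atTop (𝓝 (branchCode x)) := by
  refine tendsto_pi_nhds.2 fun j => tendsto_nhds_of_eventually_eq ?_
  rcases j with t | π
  · filter_upwards [eventually_gt_atTop t.1] with n hn
    rw [branchCode_inl, ← Bool.not_eq_true, nodeCode_inl]
    rintro rfl
    exact lt_irrefl _ hn
  · by_cases h : ∃ m, x ∈ cyl (m + 1) (π m)
    · obtain ⟨m, hm⟩ := h
      filter_upwards [eventually_gt_atTop m] with n hn
      rw [branchCode_inr.2 ⟨m, hm⟩, nodeCode_inr]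
      exact ⟨m, hn, cyl_trans hn (x.extend_node_mem_cyl n) hm⟩
    · refine Eventually.of_forall fun n => ?_
      have h1 : branchCode x (.inr π) = false := by
        rw [← Bool.not_eq_true, branchCode_inr]; exact h
      rw [h1, ← Bool.not_eq_true, nodeCode_inr]
      rintro ⟨m, hm, hx⟩
      exact h ⟨m, cyl_trans hm (mem_cyl_comm.1 (x.extend_node_mem_cyl n)) hx⟩

/-- The compactification of the set of nodes. -/
abbrev TreeCompactification : Type := closure (range nodeCode)

noncomputable def nodeIncl (s : Node) : TreeCompactification :=
  ⟨nodeCode s, subset_closure (mem_range_self s)⟩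

/-- The implication is a closed condition on `y` that holds at every node code. -/
theorem eq_nodeCode_of_mem_closure {y : Coord → Bool} (hy : y ∈ closure (range nodeCode)) {t : Node}
    (ht : y (.inl t) = true) : y = nodeCode t := by
  have hclosed : IsClosed {z : Coord → Bool | z (.inl t) = true → z = nodeCode t} := by
    have : {z : Coord → Bool | z (.inl t) = true → z = nodeCode t}
        = (fun z : Coord → Bool => z (.inl t)) ⁻¹' {false} ∪ {nodeCode t} := by
      ext z
      simp [imp_iff_not_or, or_comm]
    rw [this]
    exact ((isClosed_discrete _).preimage (continuous_apply _)).union isClosed_singleton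
  refine closure_minimal ?_ hclosed hy ht
  rintro _ ⟨s, rfl⟩ hs
  rw [nodeCode_inl.1 hs]

theorem mem_remainder_iff (y : TreeCompactification) :
    y ∈ remainder nodeIncl ↔ ∀ t, y.1 (.inl t) = false := by
  constructor
  · intro hy t
    by_contra h
    exact hy ⟨t, Subtype.ext (eq_nodeCode_of_mem_closure y.2 (by simpa using h)).symm⟩
  · rintro h ⟨t, rfl⟩
    have : nodeCode t (.inl t) = true := nodeCode_inl.2 rfl
    exact Bool.false_ne_true ((h t).symm.trans this)

theorem isClosed_remainder : IsClosed (remainder nodeIncl) := by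
  have : remainder nodeIncl
      = ⋂ t, (fun y : TreeCompactification => y.1 (.inl t)) ⁻¹' {false} := by
    ext y
    rw [mem_remainder_iff]
    simp
  rw [this]
  exact isClosed_iInter fun t =>
    (isClosed_discrete _).preimage ((continuous_apply _).comp continuous_subtype_val)

theorem isEmbedding_nodeIncl : IsEmbedding nodeIncl := by
  have hopen : ∀ t, nodeIncl ⁻¹' {y | y.1 (.inl t) = true} = {t} := by
    intro t
    ext s
    exact nodeCode_inl
  refine ⟨isInducing_iff_nhds.2 fun t => le_antisymm
    (continuous_of_discreteTopology.tendsto t).le_comap ?_, ?_⟩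
  · rw [nhds_discrete Node, le_pure_iff, ← hopen t]
    refine preimage_mem_comap (IsOpen.mem_nhds ?_ ?_)
    · exact (isOpen_discrete {true}).preimage (f := fun y : TreeCompactification => y.1 (.inl t))
        ((continuous_apply _).comp continuous_subtype_val)
    · exact nodeCode_inl.2 rfl
  · intro s t h
    refine nodeCode_inl.1 ?_
    have : nodeCode s = nodeCode t := congrArg Subtype.val h
    rw [this]
    exact nodeCode_inl.2 rfl

theorem denseRange_nodeIncl : DenseRange nodeIncl := by
  intro y
  rw [closure_subtype]
  have : ((↑) : TreeCompactification → _) '' range nodeIncl = range nodeCode := by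
    rw [← range_comp]; rfl
  rw [this]
  exact y.2

/-- The coordinates of a point of the remainder. -/
def remainderCode (y : remainder nodeIncl) : Coord → Bool := y.1.1

theorem isEmbedding_remainderCode : IsEmbedding remainderCode :=
  IsEmbedding.subtypeVal.comp IsEmbedding.subtypeVal

/-- The point of the remainder defined by a branch. -/
noncomputable def branchPoint (x : Branch) : remainder nodeIncl :=
  ⟨⟨branchCode x, mem_closure_of_tendsto (tendsto_nodeCode x) (.of_forall fun _ => ⟨_, rfl⟩)⟩,
    (mem_remainder_iff _).2 (branchCode_inl x)⟩

theorem measurable_branchCode_apply (j : Coord) : Measurable fun x => branchCode x j := by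
  refine measurable_to_bool ?_
  rcases j with t | π
  · have : (fun x => branchCode x (.inl t)) ⁻¹' {true} = ∅ := by
      ext x; simp [branchCode_inl]
    rw [this]
    exact MeasurableSet.empty
  · have : (fun x => branchCode x (.inr π)) ⁻¹' {true} = ⋃ m, cyl (m + 1) (π m) := by
      ext x; simp [branchCode_inr]
    rw [this]
    exact MeasurableSet.iUnion fun m => measurableSet_cyl _ _

/-! ### Strict positivity of the measure on the remainder -/

theorem eventually_coordinates (y : remainder nodeIncl) (F : Finset Coord) :
    ∀ᶠ s in comap nodeCode (𝓝 (remainderCode y)), ∀ j ∈ F, nodeCode s j = remainderCode y j := by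
  refine preimage_mem_comap (m := nodeCode)
    (t := {z : Coord → Bool | ∀ j ∈ F, z j = remainderCode y j}) ?_
  exact (isClopen_coordinates continuous_id F _).isOpen.mem_nhds fun _ _ => rfl

instance neBot_comap_nodeCode (y : remainder nodeIncl) :
    (comap nodeCode (𝓝 (remainderCode y))).NeBot :=
  comap_neBot_iff_compl_range.2 fun h => mem_closure_iff_nhds.1 y.1.2 _ h |>.elim
    fun _ hz => hz.1 hz.2

/-- Only finitely many nodes are shorter than `L`, and each is excluded by its own coordinate, which
vanishes at `y`. -/
theorem eventually_length (y : remainder nodeIncl) (L : ℕ) :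
    ∀ᶠ s in comap nodeCode (𝓝 (remainderCode y)), L ≤ s.1 := by
  classical
  filter_upwards [eventually_coordinates y
    ((finite_setOf_length_lt L).toFinset.image Sum.inl)] with s hs
  by_contra! h
  have := hs (.inl s) (by simpa using h)
  rw [remainderCode, (mem_remainder_iff y.1).1 y.2 s, nodeCode_inl.2 rfl] at this
  exact Bool.noConfusion this

theorem branchMeasure_coordinates_pos (y : remainder nodeIncl) (F : Finset Coord) :
    0 < branchMeasure {x | ∀ j ∈ F, branchCode x j = remainderCode y j} := by
  classical
  obtain ⟨s, hsF, hsL⟩ := ((eventually_coordinates y F).and (eventually_length y F.card)).exists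
  let T : Finset (ℕ → Branch) := F.toRight
  have hT : T.card ≤ s.1 := F.card_toRight_le.trans hsL
  refine lt_of_lt_of_le (branchMeasure_cyl_diff_tailHit_pos T hT s.extend) (measure_mono ?_)
  rintro x ⟨hxs, hxT⟩ j hj
  rcases j with t | π
  · rw [branchCode_inl]
    exact ((mem_remainder_iff y.1).1 y.2 t).symm
  · rw [← hsF _ hj, Bool.eq_iff_iff, branchCode_inr, nodeCode_inr]
    constructor
    · rintro ⟨m, hm⟩
      by_cases hms : m < s.1
      · exact ⟨m, hms, cyl_trans hms (mem_cyl_comm.1 hxs) hm⟩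
      -- A pick longer than `s` that lies on `x` would put `x` in the removed `tailHit`.
      · refine absurd (mem_iUnion₂.2 ⟨π, by simpa [T] using hj, mem_iUnion.2 ⟨m - s.1, ?_⟩⟩) hxT
        rwa [Nat.add_sub_cancel' (not_lt.1 hms)]
    · rintro ⟨m, hms, hm⟩
      exact ⟨m, cyl_trans hms hxs hm⟩

theorem supportsMeasure_remainder : SupportsMeasure (remainder nodeIncl) := by
  have : CompactSpace TreeCompactification :=
    isCompact_iff_compactSpace.1 isClosed_closure.isCompact
  have : CompactSpace (remainder nodeIncl) :=
    isCompact_iff_compactSpace.1 isClosed_remainder.isCompact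
  refine supportsMeasure_of_preimage_clopen branchMeasure branchPoint
    (fun W hW => measurableSet_preimage_clopen isEmbedding_remainderCode
      measurable_branchCode_apply hW) ?_
  rintro W hW ⟨y, hy⟩
  obtain ⟨F, hF⟩ := isEmbedding_remainderCode.exists_finset_coordinates hW.isOpen hy
  exact (branchMeasure_coordinates_pos y F).trans_le (measure_mono fun x hx => hF hx)

/-! ### Non-separability of the remainder -/

/-- Every point of the remainder lies over some branch. -/
theorem exists_branch (y : remainder nodeIncl) :
    ∃ x : Branch, ∀ π m, x ∈ cyl (m + 1) (π m) → remainderCode y (.inr π) = true := by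
  let G := Ultrafilter.of (comap nodeCode (𝓝 (remainderCode y)))
  have hG : (G : Filter Node) ≤ comap nodeCode (𝓝 (remainderCode y)) := Ultrafilter.of_le _
  -- Nodes converging to `y` along an ultrafilter have a limit branch, since the space of branches
  -- is compact.
  let x : Branch := (G.map Node.extend).lim
  have hx : Tendsto Node.extend G (𝓝 x) := (G.map Node.extend).le_nhds_lim
  refine ⟨x, fun π m hm => ?_⟩
  obtain ⟨s, ⟨hs₁, hs₂⟩, hs₃⟩ := (((hx.eventually
    ((isClopen_cyl (m + 1) (π m)).isOpen.mem_nhds hm)).and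
    (hG (eventually_length y (m + 1)))).and (hG (eventually_coordinates y {.inr π}))).exists
  rw [← hs₃ _ (Finset.mem_singleton_self _), nodeCode_inr]
  exact ⟨m, hs₂, hs₁⟩

theorem not_separableSpace_remainder :
    ¬ TopologicalSpace.SeparableSpace (remainder nodeIncl) := by
  intro _
  have : Nonempty (remainder nodeIncl) := ⟨branchPoint fun _ => 0⟩
  choose b hb using exists_branch
  let π : ℕ → Branch := fun k => b (TopologicalSpace.denseSeq (remainder nodeIncl) k)
  have hclosed : IsClosed {y | remainderCode y (.inr π) = true} :=
    (isClosed_discrete {true}).preimage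
      ((continuous_apply (Sum.inr π)).comp isEmbedding_remainderCode.continuous)
  have hall : ∀ y, remainderCode y (.inr π) = true := by
    intro y
    refine closure_minimal ?_ hclosed (TopologicalSpace.denseRange_denseSeq _ y)
    rintro _ ⟨k, rfl⟩
    exact hb _ π k (mem_cyl_self _ _)
  -- Diagonal branch: it leaves `π m` at coordinate `m`, as `+ 1` has no fixed point in `Fin (m +
  -- 2)`.
  obtain ⟨m, hm⟩ := branchCode_inr.1 (hall (branchPoint fun m => π m m + 1))
  simpa using hm m m.lt_succ_self

theorem mainTheorem2 :
    ∃ (X : Type) (_ : TopologicalSpace X) (i : ℕ → X),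
      IsCompactification i ∧
      ¬ TopologicalSpace.SeparableSpace (remainder i) ∧
      SupportsMeasure (remainder i) := by
  obtain ⟨e⟩ : Nonempty (ℕ ≃ Node) := nonempty_equiv_of_countable
  have hr : remainder (nodeIncl ∘ e) = remainder nodeIncl := by
    rw [remainder, remainder, e.surjective.range_comp]
  refine ⟨TreeCompactification, inferInstance, nodeIncl ∘ e, ⟨?_, inferInstance, ?_, ?_⟩, ?_, ?_⟩
  · exact isCompact_iff_compactSpace.1 isClosed_closure.isCompact
  · exact isEmbedding_nodeIncl.comp (e.toHomeomorphOfDiscrete).isEmbedding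
  · rw [DenseRange, e.surjective.range_comp]
    exact denseRange_nodeIncl
  · rw [hr]
    exact not_separableSpace_remainder
  · rw [hr]
    exact supportsMeasure_remainder
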